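/- Conventions. Let $R$ be a commutative unital ring and let $G$ be a finite, nonempty, simple, strongly connected directed graph with vertex set $V$. A cut-vertex of a connected graph is a vertex whose removal disconnects the underlying undirected graph. The strong blocks $G_e$ ($e\in E$) of $G$ are its maximal connected subgraphs without cut-vertices; we write $i\in e$ if $i$ is a vertex of $G_e$. Let ${\bf e}$ denote the all-ones vector and $J$ the all-ones matrix. A block-datum $\mathcal G$ consists, for each $e\in E$, of a scalar $a_e\in R$ and a square matrix $D^*_{G_e}$ over $R$, indexed by the vertices of $G_e$ and with all diagonal entries $1$. Put $D_{\mathcal G_e}:=a_e(D^*_{G_e}-J)$. The matrices $D^*_G=(m_{ij})_{i,j\in V}$ and $D_{\mathcal G}=(d_{ij})_{i,j\in V}$ are defined as follows: their principal submatrices on the vertices of each block $G_e$ are $D^*_{G_e}$ and $D_{\mathcal G_e}$, respectively; and if $i,j$ are not in a common block, then inductively $m_{ij}:=m_{iv}m_{vj}$ and $d_{ij}:=d_{iv}+m_{iv}d_{vj}$, where $v\neq i,j$ is any cut-vertex whose removal separates $i$ from $j$ (the choice of $v$ is immaterial). For a vertex $v_0$, define $\kappa(D_{\mathcal G},v_0):=\det\big(d_{ij}-d_{iv_0}-m_{iv_0}d_{v_0j}\big)_{i,j\in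 V\setminus\{v_0\}}$, and define $\kappa(D_{\mathcal G_e},v_0)$ for a vertex $v_0$ of $G_e$ in the same way from the matrices $D_{\mathcal G_e}$ and $D^*_{G_e}$. These values do not depend on $v_0$ and are written $\kappa(D_{\mathcal G})$ and $\kappa(D_{\mathcal G_e})$. For $i\in e\in E$, let $G_{i\to e}$ be the unique maximum connected induced subgraph of $G$ that contains $G_e$ and of which $i$ is not a cut-vertex. Theorem C. Assume that $D_{\mathcal G}$ and $D^*_G$ are invertible over $R$. Then all $a_e$ and all $\kappa(D_{\mathcal G_e})$ are invertible in $R$, and $$D_{\mathcal G}^{-1}=\frac{\kappa(D_{\mathcal G})}{\det(D_{\mathcal G})}\,\boldsymbol\tau_{\rm out}\boldsymbol\tau_{\rm in}^T+C_{\mathcal G}\,(D^*_G)^{-1},$$ where $\boldsymbol\tau_{\rm in}^T:={\bf e}^T(D^*_G)^{-1}$, $\boldsymbol\tau_{\rm out}:=(D^*_G)^{-1}{\bf e}$, and $C_{\mathcal G}\in R^{V\times V}$ is given as follows: for $i\in V$, $$\beta_i:=\frac{\kappa(D_{\mathcal G})}{\det(D_{\mathcal G})}\sum_{e\in E:\ i\in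 e}\frac1{a_e}\sum_{f\in E:\ G_f\subset G_{i\to e}}\frac{\det(D_{\mathcal G_f})}{\kappa(D_{\mathcal G_f})},$$ $(C_{\mathcal G})_{ii}:=\beta_i$, and $(C_{\mathcal G})_{ij}:=\beta_i-\frac1{a_e}$ for $j\neq i$, where $e$ is the unique block containing $i$ such that $j\in G_{i\to e}$. -/

import Mathlib

noncomputable section

namespace BlockGraph

variable {V : Type*} {R : Type*}

/-- A directed graph is strongly connected if there is a directed path from any vertex to any
other vertex. -/
def StronglyConnected (G : Digraph V) : Prop :=
  ∀ u v : V, Relation.ReflTransGen G.Adj u v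

/-- The underlying undirected graph of a digraph. -/
abbrev undir (G : Digraph V) : SimpleGraph V := G.toSimpleGraphInclusive

/-- The subgraph induced on `S` is connected (in the underlying undirected graph; in particular
`S` is nonempty). -/
def ConnectedOn (G : Digraph V) (S : Finset V) : Prop :=
  ((undir G).induce (S : Set V)).Connected

/-- `v` is a cut-vertex of the (connected) subgraph induced on `S`: its removal disconnects the
underlying undirected graph. -/
def IsCutVertexOf (G : Digraph V) (S : Finset V) (v : V) : Prop :=
  v ∈ S ∧ ¬ ((undir G).induce ((S : Set V) \ {v})).Preconnected

/-- `B` is the vertex set of a strong block: a maximal connected subgraph without cut-vertices.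
(Adding edges between the vertices of a connected graph creates no cut-vertex, so such a maximal
subgraph is induced, hence determined by its vertex set.) -/
def IsBlock (G : Digraph V) (B : Finset V) : Prop :=
  Maximal (fun S : Finset V => ConnectedOn G S ∧ ∀ v ∈ S, ¬ IsCutVertexOf G S v) B

/-- The set `E` of strong blocks of `G`; `e.1` is the vertex set of `e`. -/
def Block (G : Digraph V) : Type _ := {B : Finset V // IsBlock G B}

instance [Finite V] (G : Digraph V) : Finite (Block G) :=
  inferInstanceAs (Finite {B : Finset V // IsBlock G B})

instance [Finite V] (G : Digraph V) : Fintype (Block G) := Fintype.ofFinite _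

/-- An additive-multiplicative block-datum: a scalar `a e` and a square matrix `Dstar e`, indexed
by the vertices of `e` and with all diagonal entries `1`, for every strong block `e`. -/
structure BlockDatum (G : Digraph V) (R : Type*) [CommRing R] where
  a : Block G → R
  Dstar : (e : Block G) → Matrix e.1 e.1 R
  diag : ∀ (e : Block G) (i : e.1), Dstar e i i = 1

/-- The cut-vertex `v` separates `i` from `j`: the vertices `i`, `j` are joined by a path of the
underlying undirected graph, and every such path passes through `v ≠ i, j`. -/
def Separates (G : Digraph V) (v i j : V) : Prop :=
  v ≠ i ∧ v ≠ j ∧ (undir G).Reachable i j ∧ ∀ p : (undir G).Walk i j, v ∈ p.support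

theorem Separates.dist_left_lt {G : Digraph V} {v i j : V} (h : Separates G v i j) :
    (undir G).dist i v < (undir G).dist i j := by
  classical
  obtain ⟨p, hp⟩ := h.2.2.1.exists_walk_length_eq_dist
  have hv := h.2.2.2 p
  have h1 := SimpleGraph.dist_le (p.takeUntil v hv)
  have h2 := congrArg SimpleGraph.Walk.length (p.take_spec hv)
  rw [SimpleGraph.Walk.length_append] at h2
  have h3 : (p.dropUntil v hv).length ≠ 0 := fun h0 =>
    h.2.1 (SimpleGraph.Walk.eq_of_length_eq_zero h0)
  omega

theorem Separates.dist_right_lt {G : Digraph V} {v i j : V} (h : Separates G v i j) :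
    (undir G).dist v j < (undir G).dist i j := by
  classical
  obtain ⟨p, hp⟩ := h.2.2.1.exists_walk_length_eq_dist
  have hv := h.2.2.2 p
  have h1 := SimpleGraph.dist_le (p.dropUntil v hv)
  have h2 := congrArg SimpleGraph.Walk.length (p.take_spec hv)
  rw [SimpleGraph.Walk.length_append] at h2
  have h3 : (p.takeUntil v hv).length ≠ 0 := fun h0 =>
    h.1 (SimpleGraph.Walk.eq_of_length_eq_zero h0).symm
  omega

/-- The determinant `κ(D, v₀) = det (D' - u 𝟏ᵀ - m wᵀ)` formed from a distance matrix `D`, its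
multiplicative companion `M` and a vertex `v₀`: here `D'` is `D` with the row and the column of
`v₀` deleted, and `u = D(·, v₀)`, `w = D(v₀, ·)`, `m = M(·, v₀)` on the remaining vertices. -/
def kappa {ι : Type*} [Fintype ι] [DecidableEq ι] [CommRing R] (M D : Matrix ι ι R) (v₀ : ι) : R :=
  Matrix.det (Matrix.of fun i j : {x : ι // x ≠ v₀} => D i j - D i v₀ - M i v₀ * D v₀ j)

open Classical in
/-- The vertex set of `G_{i → e}`: the union of all vertex sets that contain `e` and induce a
connected subgraph of which `i` is not a cut-vertex, i.e. the maximum such vertex set. -/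
def branch [Fintype V] (G : Digraph V) (i : V) (e : Block G) : Finset V :=
  Finset.univ.filter fun j =>
    ∃ S : Finset V, e.1 ⊆ S ∧ ConnectedOn G S ∧ ¬ IsCutVertexOf G S i ∧ j ∈ S

namespace BlockDatum

variable [CommRing R] {G : Digraph V} (𝒢 : BlockDatum G R)

/-- The distance matrix `a_e (D*_e - J)` of a strong block `e`. -/
def blockD (e : Block G) : Matrix e.1 e.1 R :=
  𝒢.a e • (𝒢.Dstar e - Matrix.of fun _ _ => 1)

open Classical in
/-- The entries `m_{ij}` of the multiplicative distance matrix: the block entries if `i` and `j`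
lie in a common block, and `m_{iv} m_{vj}` with a separating cut-vertex `v` otherwise. (In a
connected graph one of the two cases occurs, and the result does not depend on the choices.) -/
def mult (i j : V) : R :=
  if h : ∃ e : Block G, i ∈ e.1 ∧ j ∈ e.1 then
    𝒢.Dstar h.choose ⟨i, h.choose_spec.1⟩ ⟨j, h.choose_spec.2⟩
  else if h : ∃ v, Separates G v i j then
    mult i h.choose * mult h.choose j
  else 0
termination_by (undir G).dist i j
decreasing_by
  · exact h.choose_spec.dist_left_lt
  · exact h.choose_spec.dist_right_lt

open Classical in
/-- The entries `d_{ij}` of the additive-multiplicative distance matrix: the entries of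
`a_e (D*_e - J)` if `i` and `j` lie in a common block `e`, and `d_{iv} + m_{iv} d_{vj}` with a
separating cut-vertex `v` otherwise. -/
def addMult (i j : V) : R :=
  if h : ∃ e : Block G, i ∈ e.1 ∧ j ∈ e.1 then
    𝒢.blockD h.choose ⟨i, h.choose_spec.1⟩ ⟨j, h.choose_spec.2⟩
  else if h : ∃ v, Separates G v i j then
    addMult i h.choose + 𝒢.mult i h.choose * addMult h.choose j
  else 0
termination_by (undir G).dist i j
decreasing_by
  · exact h.choose_spec.dist_left_lt
  · exact h.choose_spec.dist_right_lt

/-- The multiplicative distance matrix `D*_G`. -/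
def multMatrix : Matrix V V R := Matrix.of 𝒢.mult

/-- The additive-multiplicative distance matrix `D_𝒢`. -/
def distMatrix : Matrix V V R := Matrix.of 𝒢.addMult

variable [Fintype V] [DecidableEq V]

/-- `κ(D_𝒢)`, computed at the vertex `v₀`. -/
def kappaG (v₀ : V) : R := kappa 𝒢.multMatrix 𝒢.distMatrix v₀

/-- `κ(D_{𝒢_e})`, computed at the vertex `w` of the strong block `e`. -/
def kappaBlock (e : Block G) (w : e.1) : R := kappa (𝒢.Dstar e) (𝒢.blockD e) w

/-- The vector `τ_in`, with `τ_inᵀ = 𝟏ᵀ (D*_G)⁻¹`. -/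
def tauIn : V → R := Matrix.vecMul 1 (𝒢.multMatrix)⁻¹

/-- The vector `τ_out = (D*_G)⁻¹ 𝟏`. -/
def tauOut : V → R := Matrix.mulVec (𝒢.multMatrix)⁻¹ 1

/-- `κ(D_𝒢) / det(D_𝒢)`, with `κ` computed at `v₀`. -/
def ratio (v₀ : V) : R := 𝒢.kappaG v₀ * Ring.inverse 𝒢.distMatrix.det

open Classical in
/-- The scalar `β_i`; here `v₀` and `w f` are the vertices of `G` and of the strong blocks `f` at
which `κ(D_𝒢)` and `κ(D_{𝒢_f})` are computed. -/
def beta (v₀ : V) (w : (f : Block G) → f.1) (i : V) : R :=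
  𝒢.ratio v₀ *
    ∑ e : Block G with i ∈ e.1, Ring.inverse (𝒢.a e) *
      ∑ f : Block G with f.1 ⊆ branch G i e,
        (𝒢.blockD f).det * Ring.inverse (𝒢.kappaBlock f (w f))

open Classical in
/-- The matrix `C_𝒢`. For `j ≠ i` there is exactly one strong block `e` that contains `i` and for
which `j` lies in `G_{i → e}`. -/
def C (v₀ : V) (w : (f : Block G) → f.1) : Matrix V V R :=
  Matrix.of fun i j =>
    if j = i then 𝒢.beta v₀ w i
    else if h : ∃ e : Block G, i ∈ e.1 ∧ j ∈ branch G i e then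
      𝒢.beta v₀ w i - Ring.inverse (𝒢.a h.choose)
    else 0

end BlockDatum

end BlockGraph

end

/-! Write `M` for the multiplicative matrix and `D` for the distance matrix. Seen from a vertex `i`,
every block `e` has a gate `p`: all walks from `i` into `e` pass through it, so `m_ik = m_ip m_pk`
and `d_ik = d_ip + m_ip d_pk` for all `k` in `e`. Each `j ≠ i` is a non-gate vertex of exactly one
block, so sums over `V` telescope into sums over blocks (`sum_weight_mul`). This expresses `τ_in`
and `τ_out` through the blocks and gives `τ_inᵀ D = Q 𝟏ᵀ` with `Q = ∑ q_e` and `q_e = det D_e /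
κ(D_e)`. Since `κ(D, v)` is the `v`-th entry of `𝟏ᵀ adj(D) M` (`kappa_eq_adjugate`), it follows that
`Q κ = det D`; thus `ratio` is the inverse of `Q`.

It remains to show `D C = M - ratio (D τ_out) 𝟏ᵀ`. Let `b k f` be the block at `k` leading towards
the block `f`. Then `β_k` is `ratio` times the sum of the `q_f / a_(b k f)`, and for `j ∈ f` the
correction `1/a` in `C_kj` is `1 / a_(b k f)` unless `k = j`. Comparing the two shows that `∑_k d_ik
corr k j + m_ij` is constant for `j` in one block, hence for all `j` by connectedness
(`sum_addMult_mul_corr_add_mult`). What is left over is the block expansion of `D τ_out`. -/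

namespace BlockGraph

/-! ### Walks inside vertex sets, and connected sets without cut-vertices -/

section Graph

variable {V : Type*} {H : SimpleGraph V}

/-- `u` and `v` are joined by a walk all of whose vertices lie in `S`. -/
def Linked (H : SimpleGraph V) (S : Set V) (u v : V) : Prop :=
  ∃ w : H.Walk u v, ∀ x ∈ w.support, x ∈ S

theorem Linked.refl {S : Set V} {u : V} (h : u ∈ S) : Linked H S u u :=
  ⟨.nil, by simpa using h⟩

theorem Linked.symm {S : Set V} {u v : V} : Linked H S u v → Linked H S v u := by
  rintro ⟨w, hw⟩
  exact ⟨w.reverse, by simpa using hw⟩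

theorem Linked.trans {S : Set V} {u v x : V} :
    Linked H S u v → Linked H S v x → Linked H S u x := by
  rintro ⟨w, hw⟩ ⟨w', hw'⟩
  refine ⟨w.append w', fun y hy => ?_⟩
  rcases (SimpleGraph.Walk.mem_support_append_iff _ _).1 hy with h | h
  exacts [hw y h, hw' y h]

theorem Linked.mono {S T : Set V} (hST : S ⊆ T) {u v : V} : Linked H S u v → Linked H T u v :=
  fun ⟨w, hw⟩ => ⟨w, fun x hx => hST (hw x hx)⟩

theorem Linked.of_adj {S : Set V} {u v : V} (h : H.Adj u v) (hu : u ∈ S) (hv : v ∈ S) :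
    Linked H S u v :=
  ⟨.cons h .nil, by simp [hu, hv]⟩

theorem Linked.left_mem {S : Set V} {u v : V} : Linked H S u v → u ∈ S :=
  fun ⟨w, hw⟩ => hw _ w.start_mem_support

theorem Linked.right_mem {S : Set V} {u v : V} : Linked H S u v → v ∈ S :=
  fun ⟨w, hw⟩ => hw _ w.end_mem_support

theorem Linked.exists_isPath {S : Set V} {u v : V} (h : Linked H S u v) :
    ∃ w : H.Walk u v, w.IsPath ∧ ∀ x ∈ w.support, x ∈ S := by
  classical
  obtain ⟨w, hw⟩ := h
  exact ⟨w.bypass, w.bypass_isPath, fun x hx => hw x (w.support_bypass_subset_support hx)⟩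

theorem reachable_induce_iff {S : Set V} {u v : S} :
    (H.induce S).Reachable u v ↔ Linked H S u v := by
  constructor
  · rintro ⟨w⟩
    refine ⟨w.map (SimpleGraph.Embedding.induce S).toHom, fun x hx => ?_⟩
    erw [SimpleGraph.Walk.support_map, List.mem_map] at hx
    obtain ⟨y, -, rfl⟩ := hx
    exact y.2
  · rintro ⟨w, hw⟩
    exact ⟨w.induce S hw⟩

theorem preconnected_induce_iff {S : Set V} :
    (H.induce S).Preconnected ↔ ∀ u ∈ S, ∀ v ∈ S, Linked H S u v := by
  constructor
  · intro h u hu v hv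
    exact reachable_induce_iff.1 (h ⟨u, hu⟩ ⟨v, hv⟩)
  · intro h u v
    exact reachable_induce_iff.2 (h u u.2 v v.2)

/-- A nonempty vertex set that induces a connected subgraph without cut-vertices. -/
structure Sturdy (H : SimpleGraph V) (S : Set V) : Prop where
  nonempty : S.Nonempty
  linked : ∀ u ∈ S, ∀ v ∈ S, Linked H S u v
  linked_diff : ∀ x, ∀ u ∈ S, u ≠ x → ∀ v ∈ S, v ≠ x → Linked H (S \ {x}) u v

theorem connectedOn_iff {G : Digraph V} {S : Finset V} :
    ConnectedOn G S ↔ S.Nonempty ∧ ∀ u ∈ S, ∀ v ∈ S, Linked (undir G) S u v := by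
  rw [ConnectedOn, SimpleGraph.connected_iff, preconnected_induce_iff, and_comm]
  simp [Finset.Nonempty]

theorem not_isCutVertexOf_iff {G : Digraph V} {S : Finset V} {x : V} :
    ¬ IsCutVertexOf G S x ↔
      (x ∈ S → ∀ u ∈ S, u ≠ x → ∀ v ∈ S, v ≠ x → Linked (undir G) ((S : Set V) \ {x}) u v) := by
  rw [IsCutVertexOf, preconnected_induce_iff, not_and, not_not]
  simp only [Set.mem_sdiff, Set.mem_singleton_iff, Finset.mem_coe, and_imp]

theorem sturdy_iff {G : Digraph V} {S : Finset V} :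
    (ConnectedOn G S ∧ ∀ v ∈ S, ¬ IsCutVertexOf G S v) ↔ Sturdy (undir G) (S : Set V) := by
  rw [connectedOn_iff]
  simp only [not_isCutVertexOf_iff]
  constructor
  · rintro ⟨⟨h1, h2⟩, h3⟩
    refine ⟨by simpa using h1, by simpa using h2, fun x u hu hux v hv hvx => ?_⟩
    by_cases hx : x ∈ S
    · exact h3 x hx hx u hu hux v hv hvx
    · refine Linked.mono ?_ (h2 u hu v hv)
      exact fun y hy => ⟨hy, fun h => hx (h ▸ hy)⟩
  · rintro ⟨h1, h2, h3⟩
    exact ⟨⟨by simpa using h1, by simpa using h2⟩,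
      fun x _ _ u hu hux v hv hvx => h3 x u hu hux v hv hvx⟩

theorem Sturdy.linked_compl {S : Set V} (h : Sturdy H S) {x u v : V} (hu : u ∈ S) (hux : u ≠ x)
    (hv : v ∈ S) (hvx : v ≠ x) : Linked H {x}ᶜ u v :=
  (h.linked_diff x u hu hux v hv hvx).mono fun _ hy => hy.2

/-- Whichever vertex is deleted, one of the two common vertices survives and links the two sets. -/
theorem Sturdy.union {S T : Set V} (hS : Sturdy H S) (hT : Sturdy H T) {a b : V} (hab : a ≠ b)
    (haS : a ∈ S) (haT : a ∈ T) (hbS : b ∈ S) (hbT : b ∈ T) : Sturdy H (S ∪ T) := by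
  have key : ∀ x, ∃ c ∈ S ∩ T, c ≠ x := fun x => by
    by_cases h : a = x
    · exact ⟨b, ⟨hbS, hbT⟩, fun h' => hab (h.trans h'.symm)⟩
    · exact ⟨a, ⟨haS, haT⟩, h⟩
  refine ⟨hS.nonempty.inl, ?_, ?_⟩
  · have : ∀ u ∈ S ∪ T, Linked H (S ∪ T) u a := by
      rintro u (hu | hu)
      · exact (hS.linked u hu a haS).mono Set.subset_union_left
      · exact (hT.linked u hu a haT).mono Set.subset_union_right
    exact fun u hu v hv => (this u hu).trans (this v hv).symm
  · intro x
    obtain ⟨c, hc, hcx⟩ := key x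
    have : ∀ u ∈ S ∪ T, u ≠ x → Linked H ((S ∪ T) \ {x}) u c := by
      rintro u (hu | hu) hux
      · exact (hS.linked_diff x u hu hux c hc.1 hcx).mono
          (Set.sdiff_subset_sdiff_left Set.subset_union_left)
      · exact (hT.linked_diff x u hu hux c hc.2 hcx).mono
          (Set.sdiff_subset_sdiff_left Set.subset_union_right)
    exact fun u hu hux v hv hvx => (this u hu hux).trans (this v hv hvx).symm

theorem sturdy_singleton (v : V) : Sturdy H {v} := by
  refine ⟨⟨v, rfl⟩, ?_, ?_⟩
  · rintro u rfl w rfl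
    exact Linked.refl rfl
  · rintro x u rfl hu w rfl -
    exact Linked.refl ⟨rfl, hu⟩

theorem sturdy_pair {u v : V} (h : H.Adj u v) : Sturdy H {u, v} := by
  refine ⟨⟨u, Or.inl rfl⟩, ?_, ?_⟩
  · rintro a (rfl | rfl) b (rfl | rfl)
    · exact Linked.refl (Or.inl rfl)
    · exact Linked.of_adj h (Or.inl rfl) (Or.inr rfl)
    · exact Linked.of_adj h.symm (Or.inr rfl) (Or.inl rfl)
    · exact Linked.refl (Or.inr rfl)
  · rintro x a (rfl | rfl) ha b (rfl | rfl) hb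
    · exact Linked.refl ⟨Or.inl rfl, ha⟩
    · exact Linked.of_adj h ⟨Or.inl rfl, ha⟩ ⟨Or.inr rfl, hb⟩
    · exact Linked.of_adj h.symm ⟨Or.inr rfl, ha⟩ ⟨Or.inl rfl, hb⟩
    · exact Linked.refl ⟨Or.inr rfl, ha⟩

/-- Attaching an ear, i.e. a path `w` between neighbours of distinct vertices, preserves
sturdiness. -/
theorem Sturdy.union_ear {S : Set V} (hS : Sturdy H S) {p q c d : V} (hpq : p ≠ q) (hp : p ∈ S)
    (hq : q ∈ S) (hc : H.Adj c p) (hd : H.Adj d q) {w : H.Walk c d} (hw : w.IsPath)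
    (hwS : ∀ x ∈ w.support, x ∉ S) : Sturdy H (S ∪ {x | x ∈ w.support}) := by
  classical
  set T : Set V := S ∪ {x | x ∈ w.support} with hT
  have hleft : ∀ u (hu : u ∈ w.support), ∀ y ∈ (w.takeUntil u hu).support, y ∈ T :=
    fun u hu y hy => Or.inr (w.support_takeUntil_subset_support hu hy)
  have hright : ∀ u (hu : u ∈ w.support), ∀ y ∈ (w.dropUntil u hu).support, y ∈ T :=
    fun u hu y hy => Or.inr (w.support_dropUntil_subset_support hu hy)
  refine ⟨hS.nonempty.inl, ?_, ?_⟩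
  · have : ∀ u ∈ T, Linked H T u p := by
      rintro u (hu | hu)
      · exact (hS.linked u hu p hp).mono Set.subset_union_left
      · exact (Linked.symm ⟨w.takeUntil u hu, hleft u hu⟩).trans
          (Linked.of_adj hc (Or.inr w.start_mem_support) (Or.inl hp))
    exact fun u hu v hv => (this u hu).trans (this v hv).symm
  · intro x
    have hSx : ∀ u ∈ S, u ≠ x → ∀ v ∈ S, v ≠ x → Linked H (T \ {x}) u v :=
      fun u hu hux v hv hvx => (hS.linked_diff x u hu hux v hv hvx).mono
          (Set.sdiff_subset_sdiff_left Set.subset_union_left)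
    have hear : ∀ u ∈ w.support, u ≠ x → ∃ v ∈ S, v ≠ x ∧ Linked H (T \ {x}) u v := by
      intro u hu hux
      have hlink : p ≠ x → x ∉ (w.takeUntil u hu).support →
          ∃ v ∈ S, v ≠ x ∧ Linked H (T \ {x}) u v := fun hpx hx => by
        refine ⟨p, hp, hpx, ?_⟩
        have h1 : Linked H (T \ {x}) c u :=
          ⟨w.takeUntil u hu, fun y hy => ⟨hleft u hu y hy, fun h => hx (h ▸ hy)⟩⟩
        exact h1.symm.trans (Linked.of_adj hc h1.left_mem ⟨Or.inl hp, hpx⟩)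
      have hrink : q ≠ x → x ∉ (w.dropUntil u hu).support →
          ∃ v ∈ S, v ≠ x ∧ Linked H (T \ {x}) u v := fun hqx hx => by
        refine ⟨q, hq, hqx, ?_⟩
        have h1 : Linked H (T \ {x}) u d :=
          ⟨w.dropUntil u hu, fun y hy => ⟨hright u hu y hy, fun h => hx (h ▸ hy)⟩⟩
        exact h1.trans (Linked.of_adj hd h1.right_mem ⟨Or.inl hq, hqx⟩)
      -- Deleting a vertex of `S` leaves the ear whole and at least one of its feet `p`, `q`.
      -- Deleting another vertex leaves both feet, and since the path visits `x` at most once, one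
      -- of the two halves at `u` avoids it.
      by_cases hxS : x ∈ S
      · have hxw : x ∉ w.support := fun h => hwS x h hxS
        by_cases hpx : p = x
        · exact hrink (fun h => hpq (hpx.trans h.symm))
            fun h => hxw (w.support_dropUntil_subset_support hu h)
        · exact hlink hpx fun h => hxw (w.support_takeUntil_subset_support hu h)
      · have hpx : p ≠ x := fun h => hxS (h ▸ hp)
        have hqx : q ≠ x := fun h => hxS (h ▸ hq)
        by_cases hx : x ∈ (w.takeUntil u hu).support
        · refine hrink hqx fun hx' => ?_
          have hnd : ((w.takeUntil u hu).append (w.dropUntil u hu)).IsPath := by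
            rwa [w.take_spec hu]
          exact hnd.ne_of_mem_support_of_append (fun h => hux h.symm) hx hx' rfl
        · exact hlink hpx hx
    have hall : ∀ u ∈ T, u ≠ x → ∃ v ∈ S, v ≠ x ∧ Linked H (T \ {x}) u v := by
      rintro u (hu | hu) hux
      · exact ⟨u, hu, hux, Linked.refl ⟨Or.inl hu, hux⟩⟩
      · exact hear u hu hux
    intro u hu hux v hv hvx
    obtain ⟨u', hu', hux', h1⟩ := hall u hu hux
    obtain ⟨v', hv', hvx', h2⟩ := hall v hv hvx
    exact h1.trans ((hSx u' hu' hux' v' hv' hvx').trans h2.symm)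

/-- A walk that enters `B` first runs outside `B` to a neighbour of its first vertex in `B`. -/
theorem exists_entry {B : Set V} {i b : V} (w : H.Walk i b) (hi : i ∉ B) (hb : b ∈ B) :
    ∃ c p, Linked H Bᶜ i c ∧ H.Adj c p ∧ p ∈ B ∧ p ∈ w.support := by
  induction w with
  | nil => exact absurd hb hi
  | @cons u v x h w ih =>
    by_cases hv : v ∈ B
    · exact ⟨u, v, Linked.refl hi, h, hv, by simp⟩
    · obtain ⟨c, p, h1, h2, h3, h4⟩ := ih hv hb
      exact ⟨c, p, (Linked.of_adj h hi hv).trans h1, h2, h3, by simp [h4]⟩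

/-- A vertex has a neighbour from which a given other vertex can be reached while avoiding it. -/
theorem exists_adj_linked_compl (hH : H.Connected) {k j : V} (hkj : k ≠ j) :
    ∃ c, H.Adj k c ∧ Linked H {k}ᶜ c j := by
  obtain ⟨w, hw⟩ := (hH.preconnected k j).exists_isPath
  cases w with
  | nil => exact absurd rfl hkj
  | cons h w =>
    rw [SimpleGraph.Walk.cons_isPath_iff] at hw
    exact ⟨_, h, w, fun x hx hxk => hw.2 (by rw [← hxk]; exact hx)⟩

/-- The vertex `p` of `B` through which every walk from `i` enters `B`. -/
theorem exists_entry_vertex (hH : H.Connected) {B : Set V} (hB : Maximal (Sturdy H) B)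
    {i : V} (hi : i ∉ B) :
    ∃ p ∈ B, ∀ k ∈ B, k ≠ p → ∀ w : H.Walk i k, p ∈ w.support := by
  -- Two different entry vertices would span an ear on `B`, contradicting maximality.
  have huniq : ∀ c p d q, Linked H Bᶜ i c → H.Adj c p → p ∈ B → Linked H Bᶜ i d → H.Adj d q →
      q ∈ B → p = q := by
    intro c p d q hc hcp hp hd hdq hq
    by_contra hpq
    obtain ⟨w, hw, hwB⟩ := (hc.symm.trans hd).exists_isPath
    have h1 := hB.prop.union_ear hpq hp hq hcp hdq hw hwB
    exact hwB c w.start_mem_support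
      (hB.le_of_ge h1 Set.subset_union_left (Or.inr w.start_mem_support))
  obtain ⟨b, hb⟩ := hB.prop.nonempty
  obtain ⟨w⟩ := hH.preconnected i b
  obtain ⟨c, p, h1, h2, h3, -⟩ := exists_entry w hi hb
  refine ⟨p, h3, fun k hk _ w' => ?_⟩
  obtain ⟨d, q, h1', h2', h3', h4'⟩ := exists_entry w' hi hk
  rwa [huniq c p d q h1 h2 h3 h1' h2' h3']

end Graph

end BlockGraph

namespace BlockGraph

/-! ### Blocks, separation, gates and directions -/

section Blocks

variable {V : Type*} {G : Digraph V}

theorem StronglyConnected.connected_undir [Nonempty V] (h : StronglyConnected G) :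
    (undir G).Connected := by
  refine SimpleGraph.connected_iff _ |>.2 ⟨fun u v => ?_, inferInstance⟩
  induction h u v with
  | refl => exact SimpleGraph.Reachable.refl _
  | @tail b c _ hbc ih =>
    by_cases hne : b = c
    · rwa [← hne]
    · exact ih.trans (SimpleGraph.Adj.reachable
        ((SimpleGraph.fromRel_adj _ _ _).2 ⟨hne, Or.inl hbc⟩))

theorem IsBlock.maximal [Finite V] {B : Finset V} (h : IsBlock G B) :
    Maximal (Sturdy (undir G)) (B : Set V) := by
  refine ⟨sturdy_iff.1 h.prop, fun T hT hBT => ?_⟩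
  obtain ⟨T, rfl⟩ := T.toFinite.exists_finset_coe
  exact Finset.coe_subset.2 (h.le_of_ge (sturdy_iff.2 hT) (Finset.coe_subset.1 hBT))

theorem Block.sturdy (e : Block G) : Sturdy (undir G) (e.1 : Set V) := sturdy_iff.1 e.2.prop

theorem exists_block_of_sturdy [Finite V] {S : Finset V} (h : Sturdy (undir G) (S : Set V)) :
    ∃ e : Block G, S ⊆ e.1 := by
  obtain ⟨B, hSB, hB⟩ := (Set.toFinite {S : Finset V | ConnectedOn G S ∧
    ∀ v ∈ S, ¬ IsCutVertexOf G S v}).exists_le_maximal (sturdy_iff.2 h)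
  exact ⟨⟨B, hB⟩, hSB⟩

theorem exists_block_mem [Finite V] (v : V) : ∃ e : Block G, v ∈ e.1 := by
  obtain ⟨e, he⟩ := exists_block_of_sturdy (G := G) (S := {v})
    (by simpa using sturdy_singleton v)
  exact ⟨e, he (by simp)⟩

theorem exists_block_of_adj [Finite V] {u v : V} (h : (undir G).Adj u v) :
    ∃ e : Block G, u ∈ e.1 ∧ v ∈ e.1 := by
  classical
  obtain ⟨e, he⟩ := exists_block_of_sturdy (G := G) (S := {u, v})
    (by simpa using sturdy_pair h)
  exact ⟨e, he (by simp), he (by simp)⟩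

/-- Distinct blocks share at most one vertex. -/
theorem Block.eq_of_mem {e f : Block G} {a b : V} (hab : a ≠ b) (hae : a ∈ e.1)
    (haf : a ∈ f.1) (hbe : b ∈ e.1) (hbf : b ∈ f.1) : e = f := by
  classical
  have h := e.sturdy.union f.sturdy hab hae haf hbe hbf
  rw [← Finset.coe_union] at h
  have h1 := e.2.eq_of_le (sturdy_iff.2 h) Finset.subset_union_left
  have h2 := f.2.eq_of_le (sturdy_iff.2 h) Finset.subset_union_right
  exact Subtype.ext (h1.trans h2.symm)

theorem separates_iff (hG : (undir G).Connected) {v i j : V} :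
    Separates G v i j ↔ v ≠ i ∧ v ≠ j ∧ ¬ Linked (undir G) {v}ᶜ i j := by
  refine and_congr_right fun _ => and_congr_right fun _ => ?_
  rw [and_iff_right (hG.preconnected i j)]
  simp only [Linked, not_exists, not_forall, Set.mem_compl_iff, Set.mem_singleton_iff, not_not]
  exact forall_congr' fun p => ⟨fun h => ⟨v, h, rfl⟩, fun ⟨x, hx, hxv⟩ => hxv ▸ hx⟩

theorem Separates.symm {v i j : V} (h : Separates G v i j) : Separates G v j i :=
  ⟨h.2.1, h.1, h.2.2.1.symm, fun p => by simpa using h.2.2.2 p.reverse⟩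

theorem Separates.not_linked {v i j : V} (h : Separates G v i j) :
    ¬ Linked (undir G) {v}ᶜ i j := fun ⟨w, hw⟩ => hw v (h.2.2.2 w) rfl

/-- Two separating vertices `u ≠ v` of `i` and `j` occur in the same order on all walks. -/
theorem Separates.order (hG : (undir G).Connected) {u v i j : V} (huv : u ≠ v)
    (hu : Separates G u i j) (hv : Separates G v i j) :
    (Separates G u i v ∧ Separates G v u j) ∨ (Separates G v i u ∧ Separates G u v j) := by
  have h1 : Separates G u i v ∨ Separates G u v j := by
    by_contra! h
    simp only [separates_iff hG, hu.1, hu.2.1, huv, ne_eq, not_false_eq_true,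
      true_and, not_not] at h
    exact hu.not_linked (h.1.trans h.2)
  have h2 : Separates G v i u ∨ Separates G v u j := by
    by_contra! h
    simp only [separates_iff hG, hv.1, hv.2.1, huv.symm, ne_eq, not_false_eq_true,
      true_and, not_not] at h
    exact hv.not_linked (h.1.trans h.2)
  -- Comparing distances excludes the two mixed combinations.
  have t1 : Separates G u i v → ¬ Separates G v i u := fun h h' =>
    lt_asymm h.dist_left_lt h'.dist_left_lt
  have t2 : Separates G u v j → ¬ Separates G v u j := fun h h' =>
    lt_asymm h.dist_right_lt h'.dist_right_lt
  rcases h1 with h1 | h1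
  · exact Or.inl ⟨h1, h2.resolve_left (t1 h1)⟩
  · exact Or.inr ⟨h2.resolve_right (t2 h1), h1⟩

theorem not_separates_of_mem_block (e : Block G) {v i j : V} (hi : i ∈ e.1) (hj : j ∈ e.1) :
    ¬ Separates G v i j := fun h =>
  h.not_linked (e.sturdy.linked_compl hi h.1.symm hj h.2.1.symm)

/-- `p` is the vertex of the block `e` that is nearest to `i`. -/
def IsGate (G : Digraph V) (e : Block G) (i p : V) : Prop :=
  p ∈ e.1 ∧ ∀ k ∈ e.1, k ≠ p → p = i ∨ Separates G p i k

theorem exists_isGate [Finite V] (hG : (undir G).Connected) (e : Block G) (i : V) :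
    ∃ p, IsGate G e i p := by
  by_cases hi : i ∈ e.1
  · exact ⟨i, hi, fun _ _ _ => Or.inl rfl⟩
  · obtain ⟨p, hp, h⟩ := exists_entry_vertex hG e.2.maximal hi
    exact ⟨p, hp, fun k hk hkp => Or.inr
      ⟨fun h' => hi (h' ▸ hp), hkp.symm, hG.preconnected i k, h k hk hkp⟩⟩

theorem IsGate.eq_of_mem {e : Block G} {i p : V} (h : IsGate G e i p) (hi : i ∈ e.1) : p = i := by
  by_contra hne
  rcases h.2 i hi (Ne.symm hne) with h' | h'
  exacts [hne h', not_separates_of_mem_block e hi hi h']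

/-- The block `e` leads from its vertex `k` towards `j`. -/
def Toward (G : Digraph V) (k j : V) (e : Block G) : Prop :=
  k ∈ e.1 ∧ ∃ x ∈ e.1, x ≠ k ∧ Linked (undir G) {k}ᶜ x j

/-- With existence and uniqueness of the block leading from `j` to `i`, this makes `j` a non-gate
vertex of exactly one block. -/
theorem toward_iff_gate_ne (hG : (undir G).Connected) {e : Block G} {i j p : V} (hij : i ≠ j)
    (hp : IsGate G e i p) : Toward G j i e ↔ j ∈ e.1 ∧ p ≠ j := by
  refine and_congr_right fun hj => ⟨?_, fun hpj => ⟨p, hp.1, hpj, ?_⟩⟩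
  · rintro ⟨x, hx, hxj, hl⟩ rfl
    rcases hp.2 x hx hxj with h | h
    exacts [hij h.symm, h.symm.not_linked hl]
  · by_contra hl
    rcases hp.2 j hj hpj.symm with rfl | h
    · exact hl (Linked.refl hpj)
    · have h' := (separates_iff hG).2 ⟨hpj.symm, hij.symm, hl⟩
      exact lt_asymm h.dist_left_lt h'.symm.dist_left_lt

/-- Take the gate `q` of `e` seen from `y ∈ f`. If `q = k`, then `k` separates `y` from `x`,
although both reach `j` avoiding `k`. Otherwise `q ∉ f`, yet `q` would separate two vertices of `f`.
-/
theorem Toward.unique [Finite V] (hG : (undir G).Connected) {e f : Block G} {k j : V}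
    (he : Toward G k j e) (hf : Toward G k j f) : e = f := by
  obtain ⟨hke, x, hx, hxk, hxj⟩ := he
  obtain ⟨hkf, y, hy, hyk, hyj⟩ := hf
  by_contra hef
  obtain ⟨q, hq⟩ := exists_isGate hG e y
  by_cases hqk : q = k
  · subst hqk
    rcases hq.2 x hx hxk with h | h
    exacts [hyk h.symm, h.not_linked (hyj.trans hxj.symm)]
  · have hqf : q ∉ f.1 := fun hqf => hef (Block.eq_of_mem hqk hq.1 hqf hke hkf)
    rcases hq.2 k hke (Ne.symm hqk) with rfl | h
    exacts [hqf hy, not_separates_of_mem_block f hy hkf h]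

theorem exists_toward [Finite V] (hG : (undir G).Connected) {k j : V} (hkj : k ≠ j) :
    ∃ e, Toward G k j e := by
  obtain ⟨c, hc, hl⟩ := exists_adj_linked_compl hG hkj
  obtain ⟨e, hke, hce⟩ := exists_block_of_adj hc
  exact ⟨e, hke, c, hce, hc.ne', hl⟩

theorem Block.exists_mem_ne [Finite V] (hG : (undir G).Connected) {k j : V} (hkj : k ≠ j)
    (e : Block G) : ∃ x ∈ e.1, x ≠ k := by
  by_contra! h
  have hk : k ∈ e.1 := by
    obtain ⟨x, hx⟩ := e.sturdy.nonempty
    exact h x hx ▸ hx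
  obtain ⟨c, hc, -⟩ := exists_adj_linked_compl hG hkj
  obtain ⟨f, hkf, hcf⟩ := exists_block_of_adj hc
  have hef : e = f := Subtype.ext
    (e.2.eq_of_le f.2.prop fun x hx => (h x hx).symm ▸ hkf)
  exact hc.ne' (h c (hef ▸ hcf))

/-! ### Branches in terms of directions -/

section Branch

variable [Fintype V]

theorem toward_of_mem_branch (hG : (undir G).Connected) {k j : V} {e : Block G} (hk : k ∈ e.1)
    (hjk : j ≠ k) (h : j ∈ branch G k e) : Toward G k j e := by
  simp only [branch, Finset.mem_filter, Finset.mem_univ, true_and] at h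
  obtain ⟨S, heS, -, hcut, hjS⟩ := h
  obtain ⟨x, hx, hxk⟩ := e.exists_mem_ne hG hjk.symm
  exact ⟨hk, x, hx, hxk, (not_isCutVertexOf_iff.1 hcut (heS hk) x (heS hx) hxk j hjS hjk).mono
    fun y hy => hy.2⟩

theorem Block.subset_branch_self (e : Block G) (k : V) : e.1 ⊆ branch G k e := by
  intro j hj
  simp only [branch, Finset.mem_filter, Finset.mem_univ, true_and]
  exact ⟨e.1, subset_rfl, e.2.prop.1, fun h => e.2.prop.2 k h.1 h, hj⟩

theorem Toward.subset_branch (hG : (undir G).Connected) {k j : V} {e f : Block G}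
    (he : Toward G k j e) (hj : j ∈ f.1) : f.1 ⊆ branch G k e := by
  classical
  obtain ⟨hk, x, hx, hxk, hxj⟩ := he
  have hjk : j ≠ k := hxj.right_mem
  -- The witness is `k` together with the component of `j` after deletion of `k`.
  set S : Finset V := Finset.univ.filter fun y => y = k ∨ Linked (undir G) {k}ᶜ y j with hS
  have memS : ∀ y, y ∈ S ↔ y = k ∨ Linked (undir G) {k}ᶜ y j := by simp [hS]
  have hlink : ∀ y ∈ S, y ≠ k → Linked (undir G) ((S : Set V) \ {k}) y j := by
    intro y hy hyk
    obtain ⟨w, hw⟩ := ((memS y).1 hy).resolve_left hyk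
    refine ⟨w, fun z hz => ⟨?_, hw z hz⟩⟩
    exact (memS z).2 (Or.inr ⟨w.dropUntil z hz, fun t ht =>
      hw t (w.support_dropUntil_subset_support hz ht)⟩)
  have hconn : ∀ y ∈ S, Linked (undir G) S y j := by
    intro y hy
    by_cases hyk : y = k
    · subst hyk
      obtain ⟨c, hc, hl⟩ := exists_adj_linked_compl hG hjk.symm
      have hcS : c ∈ S := (memS c).2 (Or.inr hl)
      exact (Linked.of_adj hc hy hcS).trans ((hlink c hcS hc.ne').mono Set.sdiff_subset)
    · exact (hlink y hy hyk).mono Set.sdiff_subset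
  have heS : e.1 ⊆ S := fun y hy => (memS y).2 <| by
    by_cases hyk : y = k
    · exact Or.inl hyk
    · exact Or.inr ((e.sturdy.linked_compl hy hyk hx hxk).trans hxj)
  have hfS : f.1 ⊆ S := fun y hy => (memS y).2 <| by
    by_cases hyk : y = k
    · exact Or.inl hyk
    · exact Or.inr (f.sturdy.linked_compl hy hyk hj hjk)
  intro y hy
  simp only [branch, Finset.mem_filter, Finset.mem_univ, true_and]
  refine ⟨S, heS, connectedOn_iff.2 ⟨⟨k, heS hk⟩, fun u hu v hv =>
    (hconn u hu).trans (hconn v hv).symm⟩, not_isCutVertexOf_iff.2 ?_, hfS hy⟩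
  exact fun _ u hu huk v hv hvk => (hlink u hu huk).trans (hlink v hv hvk).symm

theorem mem_branch_iff_toward (hG : (undir G).Connected) {k j : V} (hjk : j ≠ k) {e : Block G} :
    k ∈ e.1 ∧ j ∈ branch G k e ↔ Toward G k j e := by
  refine ⟨fun h => toward_of_mem_branch hG h.1 hjk h.2, fun h => ⟨h.1, ?_⟩⟩
  obtain ⟨f, hf⟩ := exists_block_mem (G := G) j
  exact h.subset_branch hG hf hf

/-- For a vertex `k` and a block `f` there is exactly one block at `k` whose branch
contains `f`. -/
theorem existsUnique_subset_branch (hG : (undir G).Connected) (k : V) (f : Block G) :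
    ∃! e : Block G, k ∈ e.1 ∧ f.1 ⊆ branch G k e := by
  by_cases h : ∃ j ∈ f.1, j ≠ k
  · obtain ⟨j, hj, hjk⟩ := h
    obtain ⟨e, he⟩ := exists_toward hG hjk.symm
    refine ⟨e, ⟨he.1, he.subset_branch hG hj⟩, fun e' he' => ?_⟩
    exact (toward_of_mem_branch hG he'.1 hjk (he'.2 hj)).unique hG he
  -- Here `f` is the single vertex `k`, so by maximality it is the only block at `k`.
  · push Not at h
    have hk : k ∈ f.1 := by
      obtain ⟨x, hx⟩ := f.sturdy.nonempty
      exact h x hx ▸ hx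
    refine ⟨f, ⟨hk, f.subset_branch_self k⟩, fun e' he' => ?_⟩
    exact (Subtype.ext (f.2.eq_of_le e'.2.prop fun x hx => (h x hx).symm ▸ he'.1)).symm

end Branch

end Blocks

end BlockGraph

namespace BlockGraph

namespace BlockDatum

/-! ### Matrix entries within blocks and through gates -/

section Entries

variable {V : Type*} {R : Type*} [CommRing R] {G : Digraph V} (𝒢 : BlockDatum G R)

theorem mult_of_mem {e : Block G} {i j : V} (hi : i ∈ e.1) (hj : j ∈ e.1) :
    𝒢.mult i j = 𝒢.Dstar e ⟨i, hi⟩ ⟨j, hj⟩ := by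
  have h : ∃ e : Block G, i ∈ e.1 ∧ j ∈ e.1 := ⟨e, hi, hj⟩
  rw [mult, dif_pos h]
  -- The chosen block can differ from `e` only on the diagonal, where all blocks have the entry `1`.
  by_cases hij : i = j
  · subst hij
    rw [𝒢.diag, 𝒢.diag]
  · have key : ∀ (f : Block G) (hf : i ∈ f.1 ∧ j ∈ f.1),
        𝒢.Dstar f ⟨i, hf.1⟩ ⟨j, hf.2⟩ = 𝒢.Dstar e ⟨i, hi⟩ ⟨j, hj⟩ := by
      intro f hf
      obtain rfl := Block.eq_of_mem hij hf.1 hi hf.2 hj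
      rfl
    exact key _ h.choose_spec

theorem addMult_of_mem {e : Block G} {i j : V} (hi : i ∈ e.1) (hj : j ∈ e.1) :
    𝒢.addMult i j = 𝒢.a e * (𝒢.mult i j - 1) := by
  have h : ∃ e : Block G, i ∈ e.1 ∧ j ∈ e.1 := ⟨e, hi, hj⟩
  rw [addMult, dif_pos h, 𝒢.mult_of_mem hi hj]
  by_cases hij : i = j
  · subst hij
    simp [blockD, 𝒢.diag]
  · have key : ∀ (f : Block G) (hf : i ∈ f.1 ∧ j ∈ f.1),
        𝒢.blockD f ⟨i, hf.1⟩ ⟨j, hf.2⟩ = 𝒢.a e * (𝒢.Dstar e ⟨i, hi⟩ ⟨j, hj⟩ - 1) := by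
      intro f hf
      obtain rfl := Block.eq_of_mem hij hf.1 hi hf.2 hj
      simp [blockD]
    exact key _ h.choose_spec

theorem mult_self [Finite V] (i : V) : 𝒢.mult i i = 1 := by
  obtain ⟨e, he⟩ := exists_block_mem (G := G) i
  rw [𝒢.mult_of_mem he he, 𝒢.diag]

theorem addMult_self [Finite V] (i : V) : 𝒢.addMult i i = 0 := by
  obtain ⟨e, he⟩ := exists_block_mem (G := G) i
  rw [𝒢.addMult_of_mem he he, 𝒢.mult_self, sub_self, mul_zero]

/-- The choice of the separating vertex in the definition of the distance matrices is
immaterial. -/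
theorem mult_addMult_of_separates (hG : (undir G).Connected) {v i j : V}
    (h : Separates G v i j) :
    𝒢.mult i j = 𝒢.mult i v * 𝒢.mult v j ∧
      𝒢.addMult i j = 𝒢.addMult i v + 𝒢.mult i v * 𝒢.addMult v j := by
  induction hn : (undir G).dist i j using Nat.strong_induction_on generalizing v i j with
  | _ n ih =>
  subst hn
  have hb : ¬ ∃ e : Block G, i ∈ e.1 ∧ j ∈ e.1 := fun ⟨e, hi, hj⟩ =>
    not_separates_of_mem_block e hi hj h
  have hs : ∃ v, Separates G v i j := ⟨v, h⟩
  have hu := hs.choose_spec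
  rw [mult, addMult, dif_neg hb, dif_neg hb, dif_pos hs, dif_pos hs]
  generalize hs.choose = u at hu ⊢
  by_cases huv : u = v
  · rw [huv]
    exact ⟨rfl, rfl⟩
  -- Splitting at both vertices, in the order in which they are met, gives a common refinement of
  -- the two expansions.
  rcases hu.order hG huv h with ⟨h1, h2⟩ | ⟨h1, h2⟩
  · obtain ⟨e1, e2⟩ := ih _ h.dist_left_lt h1 rfl
    obtain ⟨e3, e4⟩ := ih _ hu.dist_right_lt h2 rfl
    rw [e1, e2, e3, e4]
    constructor <;> ring
  · obtain ⟨e1, e2⟩ := ih _ hu.dist_left_lt h1 rfl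
    obtain ⟨e3, e4⟩ := ih _ h.dist_right_lt h2 rfl
    rw [e1, e2, e3, e4]
    constructor <;> ring

variable [Finite V]

theorem mult_addMult_gate (hG : (undir G).Connected) {e : Block G} {i p k : V}
    (hp : IsGate G e i p) (hk : k ∈ e.1) :
    𝒢.mult i k = 𝒢.mult i p * 𝒢.mult p k ∧
      𝒢.addMult i k = 𝒢.addMult i p + 𝒢.mult i p * 𝒢.addMult p k := by
  by_cases hkp : k = p
  · subst hkp
    simp [𝒢.mult_self, 𝒢.addMult_self]
  · rcases hp.2 k hk hkp with rfl | h
    · simp [𝒢.mult_self, 𝒢.addMult_self]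
    · exact 𝒢.mult_addMult_of_separates hG h

theorem mult_addMult_gate' (hG : (undir G).Connected) {e : Block G} {i p k : V}
    (hp : IsGate G e i p) (hk : k ∈ e.1) :
    𝒢.mult k i = 𝒢.mult k p * 𝒢.mult p i ∧
      𝒢.addMult k i = 𝒢.addMult k p + 𝒢.mult k p * 𝒢.addMult p i := by
  by_cases hkp : k = p
  · subst hkp
    simp [𝒢.mult_self, 𝒢.addMult_self]
  · rcases hp.2 k hk hkp with rfl | h
    · simp [𝒢.mult_self, 𝒢.addMult_self]
    · exact 𝒢.mult_addMult_of_separates hG h.symm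

end Entries

end BlockDatum

/-! ### Determinant formulas for `κ` -/

section Kappa

open Matrix

variable {ι R : Type*} [Fintype ι] [DecidableEq ι] [CommRing R]

/-- A determinant with a unit vector as one of its rows. -/
theorem det_eq_of_row_eq_single (A : Matrix ι ι R) (v : ι) (hA : A v = Pi.single v 1) :
    A.det = det (Matrix.of fun i j : {x : ι // x ≠ v} => A i j) := by
  have hone : ∀ (p : ι → Prop) [DecidablePred p], (∀ x, p x ↔ x = v) →
      (A.toSquareBlockProp p).det = A v v := fun p _ hp => by
    have : Subsingleton {x // p x} :=
      ⟨fun x y => Subtype.ext (((hp x).1 x.2).trans ((hp y).1 y.2).symm)⟩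
    rw [det_eq_elem_of_subsingleton _ ⟨v, (hp v).2 rfl⟩]
    rfl
  rw [A.twoBlockTriangular_det' (fun x => x = v)]
  · refine (congrArg (· * _) ?_).trans (one_mul _)
    rw [hone _ fun _ => Iff.rfl, hA, Pi.single_eq_same]
  · rintro i rfl j hj
    rw [hA, Pi.single_eq_of_ne hj]

/-- The row and column operations defining `κ` are unimodular factors `L` and `S`, so `κ` is the
`(v, v)` entry of `adj (L D S) = adj S * adj D * adj L`. As `L` sends column `v` of `M` to the unit
vector and `𝟏ᵀ S` is the unit row, the outer adjugates contribute `𝟏ᵀ` and that column. -/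
theorem kappa_eq_adjugate (M D : Matrix ι ι R) (v : ι) (hM : M v v = 1) (hD : D v v = 0) :
    kappa M D v = ∑ i, ∑ j, D.adjugate i j * M j v := by
  set L : Matrix ι ι R := 1 - vecMulVec (fun i => M i v - (1 : Matrix ι ι R) i v) (Pi.single v 1)
    with hL
  set S : Matrix ι ι R := 1 - vecMulVec (Pi.single v 1) (fun j => 1 - (1 : Matrix ι ι R) v j)
    with hS
  have hLe : ∀ (A : Matrix ι ι R) i j,
      (L * A) i j = A i j - (M i v - (1 : Matrix ι ι R) i v) * A v j := by
    intro A i j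
    simp [hL, sub_mul, vecMulVec_mul, vecMulVec_apply]
  have hSe : ∀ (A : Matrix ι ι R) i j,
      (A * S) i j = A i j - A i v * (1 - (1 : Matrix ι ι R) v j) := by
    intro A i j
    simp [hS, mul_sub, mul_vecMulVec, vecMulVec_apply]
  have hLdet : L.det = 1 := by
    rw [hL, sub_eq_add_neg, ← neg_vecMulVec, vecMulVec_eq Unit,
      det_one_add_replicateCol_mul_replicateRow]
    simp [hM]
  have hSdet : S.det = 1 := by
    rw [hS, sub_eq_add_neg, ← neg_vecMulVec, vecMulVec_eq Unit,
      det_one_add_replicateCol_mul_replicateRow]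
    simp
  have hadj : (L * D * S).adjugate v v = kappa M D v := by
    rw [adjugate_apply, det_eq_of_row_eq_single _ v (by simp), kappa]
    congr 1
    ext i j
    simp only [Matrix.of_apply]
    rw [updateRow_ne i.2, hSe, hLe, hLe]
    simp [one_apply_ne i.2, one_apply_ne j.2.symm, hD]
    ring
  rw [← hadj, adjugate_mul_distrib, adjugate_mul_distrib]
  have hLadj : ∀ j, L.adjugate j v = M j v := by
    intro j
    have h : L *ᵥ (fun i => M i v) = Pi.single v 1 := by
      ext i
      have := hLe (Matrix.of fun i _ => M i v : Matrix ι ι R) i v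
      simp only [Matrix.mul_apply, Matrix.of_apply, hM] at this
      rw [mulVec, dotProduct, this]
      by_cases hi : i = v
      · subst hi; simp [hM]
      · simp [hi]
    have h2 : L.adjugate *ᵥ (L *ᵥ (fun i => M i v)) = fun i => M i v := by
      rw [mulVec_mulVec, adjugate_mul, hLdet, one_smul, one_mulVec]
    rw [h] at h2
    simpa using congrFun h2 j
  have hSadj : ∀ j, S.adjugate v j = 1 := by
    intro j
    have h : (fun _ => (1 : R)) ᵥ* S = Pi.single v 1 := by
      ext i
      have := hSe (Matrix.of fun _ _ => 1 : Matrix ι ι R) v i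
      simp only [Matrix.mul_apply, Matrix.of_apply] at this
      rw [vecMul, dotProduct, this]
      by_cases hi : i = v
      · subst hi; simp
      · simp [one_apply_ne (Ne.symm hi), hi]
    have h2 : ((fun _ => (1 : R)) ᵥ* S) ᵥ* S.adjugate = fun _ => 1 := by
      rw [vecMul_vecMul, mul_adjugate, hSdet, one_smul, vecMul_one]
    rw [h] at h2
    simpa using congrFun h2 j
  simp only [Matrix.mul_apply, hSadj, one_mul, hLadj, Finset.mul_sum]

/-- For a single block, `κ` is the determinant of the multiplicative matrix up to a power of the
scalar. -/
theorem kappa_smul_sub_one (M : Matrix ι ι R) (a : R) (v : ι) (hM : ∀ i, M i i = 1) :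
    kappa M (a • (M - Matrix.of fun _ _ => 1)) v = a ^ (Fintype.card ι - 1) * M.det := by
  -- Schur complement at the pivot `M v v = 1`; in `κ` the constants cancel and leave `a` times
  -- these entries.
  have h : M.det = det (Matrix.of fun i j : {x : ι // x ≠ v} => M i j - M i v * M v j) := by
    set B : Matrix ι ι R :=
      Matrix.of fun i j => if i = v then M v j else M i j - M i v * M v j with hB
    rw [det_eq_of_forall_row_eq_smul_add_const (B := B) (fun i => if i = v then 0 else M i v) v
      (by simp), ← det_transpose, det_eq_of_row_eq_single _ v, ← det_transpose]
    · congr 1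
      ext i j
      simp [hB, i.2]
    · ext i
      by_cases hi : i = v <;> simp [hB, hi, hM]
    · intro i j
      by_cases hi : i = v <;> simp [hB, hi]
  have hcard : Fintype.card {x : ι // x ≠ v} = Fintype.card ι - 1 := by
    rw [Fintype.card_subtype_compl, Fintype.card_subtype_eq]
  rw [h, ← hcard, ← det_smul, kappa]
  congr 1
  ext i j
  simp
  ring

end Kappa

end BlockGraph

noncomputable section

namespace BlockGraph

open Matrix

/-! ### From block sums to global sums -/

section Gates

variable {V : Type*} [Fintype V] {G : Digraph V}

theorem sum_block_sub_gate (hG : (undir G).Connected) {A : Type*} [AddCommGroup A]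
    {i : V} {p : Block G → V} (hp : ∀ e, IsGate G e i (p e)) (g : V → A) :
    ∑ e : Block G, (∑ j ∈ e.1, g j - g (p e)) = ∑ j, g j - g i := by
  classical
  have h1 : ∀ e : Block G, ∑ j ∈ e.1, g j - g (p e) =
      ∑ j, if j ∈ e.1 ∧ p e ≠ j then g j else 0 := by
    intro e
    rw [← Finset.sum_erase_eq_sub (hp e).1, ← Finset.sum_filter]
    refine Finset.sum_congr ?_ fun _ _ => rfl
    ext j
    simp [and_comm, eq_comm]
  have h2 : ∀ j, (∑ e : Block G, if j ∈ e.1 ∧ p e ≠ j then g j else 0) =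
      if j ≠ i then g j else 0 := by
    intro j
    split_ifs with hji
    · obtain ⟨e, he⟩ := exists_toward hG hji
      rw [Finset.sum_eq_single e, if_pos ((toward_iff_gate_ne hG hji.symm (hp e)).1 he)]
      · intro f _ hfe
        rw [if_neg fun h => hfe (((toward_iff_gate_ne hG hji.symm (hp f)).2 h).unique hG he)]
      · simp
    · push Not at hji
      subst hji
      exact Finset.sum_eq_zero fun e _ => if_neg fun h => h.2 ((hp e).eq_of_mem h.1)
  simp only [h1]
  rw [Finset.sum_comm, Finset.sum_congr rfl fun j _ => h2 j, ← Finset.sum_filter,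
    Finset.filter_ne', Finset.sum_erase_eq_sub (Finset.mem_univ i)]

/-- Subtracting the unweighted block sum from `H` leaves `h e` minus the non-gate part of block `e`;
those parts add up to the sum over all vertices other than `i`. -/
theorem sum_weight_mul [DecidableEq V] (hG : (undir G).Connected) {R : Type*} [CommRing R]
    {i : V} {p : Block G → V} (hp : ∀ e, IsGate G e i (p e)) (t : Block G → V → R) (g : V → R)
    (h : Block G → R) (H : ∀ e : Block G, ∑ j ∈ e.1, t e j * g j = h e + g (p e)) :
    ∑ j, (1 + ∑ e : Block G with j ∈ e.1, (t e j - 1)) * g j = ∑ e, h e + g i := by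
  have h1 : ∀ j, (1 + ∑ e : Block G with j ∈ e.1, (t e j - 1)) * g j =
      g j + ∑ e : Block G, if j ∈ e.1 then (t e j - 1) * g j else 0 := by
    intro j
    rw [add_mul, one_mul, Finset.sum_mul, Finset.sum_filter]
  have h2 : ∀ e : Block G, (∑ j, if j ∈ e.1 then (t e j - 1) * g j else 0) =
      h e - (∑ j ∈ e.1, g j - g (p e)) := by
    intro e
    rw [← Finset.sum_filter, Finset.filter_mem_eq_inter, Finset.univ_inter]
    simp only [sub_mul, one_mul, Finset.sum_sub_distrib, H]
    ring
  simp only [h1, Finset.sum_add_distrib]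
  rw [Finset.sum_comm, Finset.sum_congr rfl fun e _ => h2 e, Finset.sum_sub_distrib,
    sum_block_sub_gate hG hp]
  ring

end Gates

/-! ### Block vectors, invertibility of the block data, and the global `τ` vectors -/

namespace BlockDatum

variable {V : Type*} [DecidableEq V] {R : Type*} [CommRing R] {G : Digraph V}
  (𝒢 : BlockDatum G R)

/-- The row vector `𝟏ᵀ (D*_e)⁻¹` of a block, extended by zero. -/
def blockIn (e : Block G) (j : V) : R :=
  if h : j ∈ e.1 then (1 ᵥ* (𝒢.Dstar e)⁻¹) ⟨j, h⟩ else 0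

/-- The column vector `(D*_e)⁻¹ 𝟏` of a block, extended by zero. -/
def blockOut (e : Block G) (j : V) : R :=
  if h : j ∈ e.1 then ((𝒢.Dstar e)⁻¹ *ᵥ 1) ⟨j, h⟩ else 0

/-- The sum of the entries of the inverse of the multiplicative matrix of a block. -/
def blockSum (e : Block G) : R := 1 ⬝ᵥ ((𝒢.Dstar e)⁻¹ *ᵥ 1)

/-- The quotient `det(D_e) / κ(D_e)` of a block. -/
def blockQuot (e : Block G) : R := 𝒢.a e * (1 - 𝒢.blockSum e)

theorem sum_blockOut (e : Block G) : ∑ j ∈ e.1, 𝒢.blockOut e j = 𝒢.blockSum e := by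
  rw [← Finset.sum_coe_sort e.1, blockSum, dotProduct]
  simp [blockOut]

theorem sum_blockIn (e : Block G) : ∑ j ∈ e.1, 𝒢.blockIn e j = 𝒢.blockSum e := by
  rw [← Finset.sum_coe_sort e.1, blockSum, dotProduct_mulVec, dotProduct]
  simp [blockIn]

section Weights

variable {𝒢} {e : Block G} (hM : IsUnit (𝒢.Dstar e)) {p : V} (hp : p ∈ e.1)
include hM hp

theorem sum_blockOut_mult : ∑ j ∈ e.1, 𝒢.blockOut e j * 𝒢.mult p j = 1 := by
  have h : (𝒢.Dstar e *ᵥ ((𝒢.Dstar e)⁻¹ *ᵥ 1)) ⟨p, hp⟩ = 1 := by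
    rw [mulVec_mulVec, mul_nonsing_inv _ ((isUnit_iff_isUnit_det _).1 hM), one_mulVec]
    rfl
  rw [← h, ← Finset.sum_coe_sort e.1]
  conv_rhs => rw [mulVec, dotProduct]
  refine Finset.sum_congr rfl fun j _ => ?_
  rw [𝒢.mult_of_mem hp j.2, blockOut, dif_pos j.2, mul_comm]

theorem sum_blockIn_mult : ∑ j ∈ e.1, 𝒢.blockIn e j * 𝒢.mult j p = 1 := by
  have h : ((1 ᵥ* (𝒢.Dstar e)⁻¹) ᵥ* 𝒢.Dstar e) ⟨p, hp⟩ = 1 := by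
    rw [vecMul_vecMul, nonsing_inv_mul _ ((isUnit_iff_isUnit_det _).1 hM), vecMul_one]
    rfl
  rw [← h, ← Finset.sum_coe_sort e.1]
  conv_rhs => rw [vecMul, dotProduct]
  refine Finset.sum_congr rfl fun j _ => ?_
  rw [𝒢.mult_of_mem j.2 hp, blockIn, dif_pos j.2]

theorem sum_blockOut_addMult :
    ∑ j ∈ e.1, 𝒢.blockOut e j * 𝒢.addMult p j = 𝒢.blockQuot e := by
  rw [blockQuot, ← sum_blockOut_mult hM hp, ← sum_blockOut, ← Finset.sum_sub_distrib,
    Finset.mul_sum]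
  refine Finset.sum_congr rfl fun j hj => ?_
  rw [𝒢.addMult_of_mem hp hj]
  ring

theorem sum_blockIn_addMult :
    ∑ j ∈ e.1, 𝒢.blockIn e j * 𝒢.addMult j p = 𝒢.blockQuot e := by
  rw [blockQuot, ← sum_blockIn_mult hM hp, ← sum_blockIn, ← Finset.sum_sub_distrib,
    Finset.mul_sum]
  refine Finset.sum_congr rfl fun j hj => ?_
  rw [𝒢.addMult_of_mem hj hp]
  ring

end Weights

theorem kappaBlock_eq (e : Block G) (w : e.1) :
    𝒢.kappaBlock e w = 𝒢.a e ^ (e.1.card - 1) * (𝒢.Dstar e).det := by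
  rw [kappaBlock, blockD, kappa_smul_sub_one _ _ _ (𝒢.diag e), Fintype.card_coe]

/-- Subtracting `J` is a rank-one update, so the matrix determinant lemma gives `det D_e = a^n
det(D*_e) (1 - s)` with `s` the `blockSum`, while `κ` carries `a^(n-1)`. -/
theorem det_blockD_mul_inverse (e : Block G) (ha : IsUnit (𝒢.a e))
    (hM : IsUnit (𝒢.Dstar e)) (w : e.1) :
    (𝒢.blockD e).det * Ring.inverse (𝒢.kappaBlock e w) = 𝒢.blockQuot e := by
  have hdet := (isUnit_iff_isUnit_det _).1 hM
  have hκ : IsUnit (𝒢.kappaBlock e w) := by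
    rw [kappaBlock_eq]
    exact (ha.pow _).mul hdet
  have h1 : (𝒢.blockD e).det = 𝒢.blockQuot e * 𝒢.kappaBlock e w := by
    have hJ : 𝒢.Dstar e - Matrix.of (fun _ _ => 1) =
        𝒢.Dstar e + replicateCol Unit (fun _ : e.1 => (-1 : R)) * replicateRow Unit (1 : e.1 → R) := by
      ext i j
      simp [Matrix.mul_apply, sub_eq_add_neg]
    have hsum : (1 + replicateRow Unit (1 : e.1 → R) * (𝒢.Dstar e)⁻¹ *
        replicateCol Unit fun _ : e.1 => (-1 : R)).det =
        1 - 𝒢.blockSum e := by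
      rw [det_unique, Matrix.add_apply, Matrix.mul_assoc, Matrix.mul_apply, blockSum, dotProduct,
        Matrix.one_apply_eq, sub_eq_add_neg, ← Finset.sum_neg_distrib]
      simp [Matrix.mul_apply, mulVec, dotProduct]
    have hcard : 0 < e.1.card := Finset.card_pos.2 ⟨w, w.2⟩
    rw [blockD, det_smul, hJ, det_add_replicateCol_mul_replicateRow hdet, hsum, kappaBlock_eq,
      blockQuot, Fintype.card_coe]
    obtain ⟨n, hn⟩ := Nat.exists_eq_add_of_lt hcard
    rw [hn]
    simp only [zero_add, Nat.add_sub_cancel, pow_succ]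
    ring
  rw [h1, mul_assoc, Ring.mul_inverse_cancel _ hκ, mul_one]

variable [Fintype V]

/-- The blocks of an invertible multiplicative distance matrix are invertible. -/
theorem isUnit_Dstar (hG : (undir G).Connected) (hM : IsUnit 𝒢.multMatrix) (e : Block G) :
    IsUnit (𝒢.Dstar e) := by
  obtain ⟨N, hN⟩ := hM.exists_right_inv
  choose p hp using fun i => exists_isGate hG e i
  -- Rows of `M` indexed by `e` factor through the gates; grouping vertices by gate turns a corner
  -- of `M * N = 1` into `Dstar e * X = 1`.
  let X : Matrix e.1 e.1 R := Matrix.of fun q l =>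
    ∑ i with p i = q.1, 𝒢.mult (p i) i * N i l
  refine IsUnit.of_mul_eq_one X ?_
  ext k l
  have h1 : (𝒢.Dstar e * X) k l =
      ∑ q ∈ e.1, ∑ i with p i = q, 𝒢.mult k (p i) * (𝒢.mult (p i) i * N i l) := by
    rw [Matrix.mul_apply, ← Finset.sum_coe_sort e.1]
    refine Finset.sum_congr rfl fun q _ => ?_
    refine (Finset.mul_sum _ _ _).trans (Finset.sum_congr rfl fun i hi => ?_)
    rw [(Finset.mem_filter.1 hi).2, 𝒢.mult_of_mem k.2 q.2]
  rw [h1, Finset.sum_fiberwise_of_maps_to fun i _ => (hp i).1]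
  have h2 := congrFun (congrFun hN k) l
  rw [Matrix.mul_apply] at h2
  have h3 : (1 : Matrix e.1 e.1 R) k l = (1 : Matrix V V R) k l := by
    by_cases hkl : k = l
    · rw [hkl, Matrix.one_apply_eq, Matrix.one_apply_eq]
    · rw [Matrix.one_apply_ne hkl, Matrix.one_apply_ne fun h => hkl (Subtype.ext h)]
  rw [h3, ← h2]
  refine Finset.sum_congr rfl fun i _ => ?_
  rw [← mul_assoc, ← (𝒢.mult_addMult_gate' hG (hp i) k.2).1, multMatrix, Matrix.of_apply]

/-- The difference of two columns of `D` belonging to `e` is divisible by `a e`, and a left inverse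
maps it to a vector with an entry `1`. -/
theorem isUnit_a (hG : (undir G).Connected) (hD : IsUnit 𝒢.distMatrix) (e : Block G) :
    IsUnit (𝒢.a e) := by
  obtain ⟨N, hN⟩ := hD.exists_left_inv
  have hN' : ∀ k l, ∑ i, N k i * 𝒢.addMult i l = (1 : Matrix V V R) k l := fun k l => by
    rw [← hN, Matrix.mul_apply]; rfl
  choose p hp using fun i => exists_isGate hG e i
  obtain ⟨k, hk⟩ := e.sturdy.nonempty
  by_cases h : ∃ l ∈ e.1, l ≠ k
  · obtain ⟨l, hl, hlk⟩ := h
    have h1 : ∀ i, 𝒢.addMult i k - 𝒢.addMult i l =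
        𝒢.a e * (𝒢.mult i (p i) * (𝒢.mult (p i) k - 𝒢.mult (p i) l)) := by
      intro i
      rw [(𝒢.mult_addMult_gate hG (hp i) hk).2, (𝒢.mult_addMult_gate hG (hp i) hl).2,
        𝒢.addMult_of_mem (hp i).1 hk, 𝒢.addMult_of_mem (hp i).1 hl]
      ring
    refine IsUnit.of_mul_eq_one
      (∑ i, N k i * (𝒢.mult i (p i) * (𝒢.mult (p i) k - 𝒢.mult (p i) l))) ?_
    have h2 : ∑ i, N k i * (𝒢.addMult i k - 𝒢.addMult i l) = 1 := by
      simp only [mul_sub, Finset.sum_sub_distrib, hN']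
      simp [Matrix.one_apply_ne hlk.symm]
    rw [← h2, Finset.mul_sum]
    refine Finset.sum_congr rfl fun i _ => ?_
    rw [h1]
    ring
  -- In a one-vertex graph `D` is zero, so its invertibility forces the ring to be trivial.
  · have hV : ∀ i, i = k := by
      by_contra! hi
      obtain ⟨i, hik⟩ := hi
      exact h (e.exists_mem_ne hG hik.symm)
    have h2 := hN' k k
    rw [Finset.sum_eq_zero fun i _ => by rw [hV i, 𝒢.addMult_self, mul_zero],
      Matrix.one_apply_eq] at h2
    have := subsingleton_of_zero_eq_one h2
    exact isUnit_of_subsingleton _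

section Global

variable {𝒢} (hG : (undir G).Connected) (hM : IsUnit 𝒢.multMatrix)
include hG hM

theorem tauIn_apply (j : V) :
    𝒢.tauIn j = 1 + ∑ e : Block G with j ∈ e.1, (𝒢.blockIn e j - 1) := by
  set t : V → R := fun j => 1 + ∑ e : Block G with j ∈ e.1, (𝒢.blockIn e j - 1) with ht
  have h : t ᵥ* 𝒢.multMatrix = 1 := by
    ext i
    choose p hp using fun e : Block G => exists_isGate hG e i
    have := sum_weight_mul hG hp 𝒢.blockIn (fun j => 𝒢.mult j i) (fun _ => 0) fun e => by
      rw [zero_add, ← one_mul (𝒢.mult (p e) i),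
        ← sum_blockIn_mult (𝒢.isUnit_Dstar hG hM e) (hp e).1, Finset.sum_mul]
      refine Finset.sum_congr rfl fun j hj => ?_
      rw [(𝒢.mult_addMult_gate' hG (hp e) hj).1, mul_assoc]
    rw [Finset.sum_const_zero, zero_add, 𝒢.mult_self] at this
    exact this
  rw [tauIn, ← h, vecMul_vecMul, mul_nonsing_inv _ ((isUnit_iff_isUnit_det _).1 hM), vecMul_one]

theorem tauOut_apply (j : V) :
    𝒢.tauOut j = 1 + ∑ e : Block G with j ∈ e.1, (𝒢.blockOut e j - 1) := by
  set t : V → R := fun j => 1 + ∑ e : Block G with j ∈ e.1, (𝒢.blockOut e j - 1) with ht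
  have h : 𝒢.multMatrix *ᵥ t = 1 := by
    ext i
    choose p hp using fun e : Block G => exists_isGate hG e i
    have := sum_weight_mul hG hp 𝒢.blockOut (fun j => 𝒢.mult i j) (fun _ => 0) fun e => by
      rw [zero_add, ← mul_one (𝒢.mult i (p e)),
        ← sum_blockOut_mult (𝒢.isUnit_Dstar hG hM e) (hp e).1, Finset.mul_sum]
      refine Finset.sum_congr rfl fun j hj => ?_
      rw [(𝒢.mult_addMult_gate hG (hp e) hj).1]
      ring
    rw [Finset.sum_const_zero, zero_add, 𝒢.mult_self] at this
    rw [mulVec, dotProduct_comm]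
    exact this
  rw [tauOut, ← h, mulVec_mulVec, nonsing_inv_mul _ ((isUnit_iff_isUnit_det _).1 hM), one_mulVec]

theorem tauIn_vecMul_distMatrix (i : V) :
    (𝒢.tauIn ᵥ* 𝒢.distMatrix) i = ∑ e, 𝒢.blockQuot e := by
  classical
  choose p hp using fun e : Block G => exists_isGate hG e i
  have := sum_weight_mul hG hp 𝒢.blockIn (fun j => 𝒢.addMult j i) 𝒢.blockQuot fun e => by
    have hM' := 𝒢.isUnit_Dstar hG hM e
    rw [← sum_blockIn_addMult hM' (hp e).1, ← one_mul (𝒢.addMult (p e) i),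
      ← sum_blockIn_mult hM' (hp e).1, Finset.sum_mul, ← Finset.sum_add_distrib]
    refine Finset.sum_congr rfl fun j hj => ?_
    rw [(𝒢.mult_addMult_gate' hG (hp e) hj).2]
    ring
  rw [𝒢.addMult_self, add_zero] at this
  rw [← this, vecMul, dotProduct]
  refine Finset.sum_congr rfl fun j _ => ?_
  rw [tauIn_apply hG hM]
  rfl

theorem distMatrix_mulVec_tauOut {i : V} {p : Block G → V} (hp : ∀ e, IsGate G e i (p e))
    (ha : ∀ e, IsUnit (𝒢.a e)) :
    (𝒢.distMatrix *ᵥ 𝒢.tauOut) i = ∑ e, 𝒢.blockQuot e *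
      (𝒢.mult i (p e) - 𝒢.addMult i (p e) * Ring.inverse (𝒢.a e)) := by
  classical
  have := sum_weight_mul hG hp 𝒢.blockOut (fun j => 𝒢.addMult i j) (fun e => 𝒢.blockQuot e *
      (𝒢.mult i (p e) - 𝒢.addMult i (p e) * Ring.inverse (𝒢.a e))) fun e => by
    have hM' := 𝒢.isUnit_Dstar hG hM e
    have h1 : ∑ j ∈ e.1, 𝒢.blockOut e j * 𝒢.addMult i j =
        𝒢.addMult i (p e) * 𝒢.blockSum e + 𝒢.mult i (p e) * 𝒢.blockQuot e := by
      rw [← sum_blockOut_addMult hM' (hp e).1, ← sum_blockOut, Finset.mul_sum, Finset.mul_sum,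
        ← Finset.sum_add_distrib]
      refine Finset.sum_congr rfl fun j hj => ?_
      rw [(𝒢.mult_addMult_gate hG (hp e) hj).2]
      ring
    rw [h1, blockQuot]
    linear_combination (𝒢.addMult i (p e) * (1 - 𝒢.blockSum e)) *
      Ring.mul_inverse_cancel _ (ha e)
  rw [𝒢.addMult_self, add_zero] at this
  rw [← this, mulVec, dotProduct]
  refine Finset.sum_congr rfl fun j _ => ?_
  rw [tauOut_apply hG hM, mul_comm]
  rfl

/-- Multiplying `κ = 𝟏ᵀ adj(D) M e_v` by the sum turns `𝟏ᵀ` into `τ_inᵀ D`; then `D adj(D) = det D`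
and `τ_inᵀ M = 𝟏ᵀ` leave `det D`. -/
theorem sum_blockQuot_mul_ratio (hD : IsUnit 𝒢.distMatrix) (v : V) :
    (∑ e, 𝒢.blockQuot e) * 𝒢.ratio v = 1 := by
  have hdet := (isUnit_iff_isUnit_det _).1 hD
  have h1 : 𝒢.kappaG v = (1 ᵥ* 𝒢.distMatrix.adjugate) ⬝ᵥ fun j => 𝒢.mult j v := by
    rw [kappaG, kappa_eq_adjugate 𝒢.multMatrix 𝒢.distMatrix v (𝒢.mult_self v : _) (𝒢.addMult_self v : _), Finset.sum_comm]
    simp only [dotProduct, vecMul, Finset.sum_mul, Pi.one_apply, one_mul]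
    rfl
  have h2 : (∑ e, 𝒢.blockQuot e) • (1 : V → R) = 𝒢.tauIn ᵥ* 𝒢.distMatrix := by
    ext i
    rw [tauIn_vecMul_distMatrix hG hM]
    simp
  have h3 : (𝒢.tauIn ⬝ᵥ fun j => 𝒢.mult j v) = 1 := by
    have h : (𝒢.tauIn ᵥ* 𝒢.multMatrix) v = 1 := by
      rw [tauIn, vecMul_vecMul, nonsing_inv_mul _ ((isUnit_iff_isUnit_det _).1 hM), vecMul_one]
      rfl
    exact h
  have h4 : (∑ e, 𝒢.blockQuot e) * 𝒢.kappaG v = 𝒢.distMatrix.det := by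
    rw [h1, ← smul_eq_mul, ← smul_dotProduct, ← smul_vecMul, h2, vecMul_vecMul, mul_adjugate,
      vecMul_smul, vecMul_one, smul_dotProduct, h3, smul_eq_mul, mul_one]
  rw [ratio, ← mul_assoc, h4, Ring.mul_inverse_cancel _ hdet]

end Global

end BlockDatum

end BlockGraph

end

noncomputable section

namespace BlockGraph

/-! ### The product of the distance matrix with `C` -/

namespace BlockDatum

open Matrix

variable {V : Type*} [Fintype V] [DecidableEq V] {R : Type*} [CommRing R] {G : Digraph V}
  {𝒢 : BlockDatum G R}

theorem beta_eq (hM : ∀ e, IsUnit (𝒢.Dstar e)) (ha : ∀ e, IsUnit (𝒢.a e)) (v₀ : V)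
    (w : (f : Block G) → f.1) {k : V} {b : Block G → Block G}
    (hb : ∀ f e, k ∈ e.1 ∧ f.1 ⊆ branch G k e ↔ e = b f) :
    𝒢.beta v₀ w k = 𝒢.ratio v₀ * ∑ f, Ring.inverse (𝒢.a (b f)) * 𝒢.blockQuot f := by
  classical
  rw [beta]
  congr 1
  have h1 : ∀ f : Block G, (𝒢.blockD f).det * Ring.inverse (𝒢.kappaBlock f (w f)) =
      𝒢.blockQuot f := fun f => 𝒢.det_blockD_mul_inverse f (ha f) (hM f) (w f)
  simp only [h1, Finset.mul_sum, Finset.sum_filter]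
  rw [Finset.sum_congr rfl fun e _ => show _ = ∑ f, if e = b f then
    Ring.inverse (𝒢.a e) * 𝒢.blockQuot f else 0 from ?_, Finset.sum_comm]
  · simp
  · simp only [← hb]
    split_ifs with hk <;> simp [hk]

/-- The scalar `1 / a_e` subtracted from `β_k` in the entry `(C_𝒢)_{kj}`. -/
def corr (𝒢 : BlockDatum G R) (k j : V) : R :=
  open Classical in
  if j = k then 0
  else if h : ∃ e : Block G, k ∈ e.1 ∧ j ∈ branch G k e then Ring.inverse (𝒢.a h.choose)
  else 0

theorem C_apply (hG : (undir G).Connected) (v₀ : V) (w : (f : Block G) → f.1) (k j : V) :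
    𝒢.C v₀ w k j = 𝒢.beta v₀ w k - 𝒢.corr k j := by
  rw [C, Matrix.of_apply, corr]
  by_cases hjk : j = k
  · simp [hjk]
  · have h : ∃ e : Block G, k ∈ e.1 ∧ j ∈ branch G k e := by
      obtain ⟨e, he⟩ := exists_toward hG (Ne.symm hjk)
      exact ⟨e, (mem_branch_iff_toward hG hjk).2 he⟩
    rw [if_neg hjk, if_neg hjk, dif_pos h, dif_pos h]

theorem corr_self (k : V) : 𝒢.corr k k = 0 := by simp [corr]

theorem corr_of_ne (hG : (undir G).Connected) {k j : V} (hjk : j ≠ k) {e : Block G}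
    (hk : k ∈ e.1) (hj : j ∈ branch G k e) : 𝒢.corr k j = Ring.inverse (𝒢.a e) := by
  have h : ∃ e : Block G, k ∈ e.1 ∧ j ∈ branch G k e := ⟨e, hk, hj⟩
  rw [corr, if_neg hjk, dif_pos h, ((mem_branch_iff_toward hG hjk).1 h.choose_spec).unique hG
    ((mem_branch_iff_toward hG hjk).1 ⟨hk, hj⟩)]

section Sums

variable (hG : (undir G).Connected) {b : V → Block G → Block G}
  (hb : ∀ k f e, k ∈ e.1 ∧ f.1 ⊆ branch G k e ↔ e = b k f)
include hG hb

/-- For `k ≠ j` the blocks at `k` leading to `j` and to `f` coincide; only `k = j` differs, where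
the block is `f` itself and `corr` vanishes. -/
theorem sum_addMult_mul_inverse (i : V) {j : V} {f : Block G} (hj : j ∈ f.1) :
    ∑ k, 𝒢.addMult i k * Ring.inverse (𝒢.a (b k f)) =
      ∑ k, 𝒢.addMult i k * 𝒢.corr k j + 𝒢.addMult i j * Ring.inverse (𝒢.a f) := by
  rw [← sub_eq_iff_eq_add', ← Finset.sum_sub_distrib, Finset.sum_eq_single j]
  · rw [corr_self, ← (hb j f f).1 ⟨hj, f.subset_branch_self j⟩, mul_zero, sub_zero]
  · intro k _ hkj
    have h := (hb k f _).2 rfl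
    rw [corr_of_ne hG hkj.symm h.1 (h.2 hj), sub_self]
  · simp

variable (ha : ∀ e, IsUnit (𝒢.a e))
include ha

theorem sum_addMult_mul_inverse_gate {i j p : V} {f : Block G} (hp : IsGate G f i p)
    (hj : j ∈ f.1) :
    ∑ k, 𝒢.addMult i k * Ring.inverse (𝒢.a (b k f)) =
      ∑ k, 𝒢.addMult i k * 𝒢.corr k j + 𝒢.mult i j -
        (𝒢.mult i p - 𝒢.addMult i p * Ring.inverse (𝒢.a f)) := by
  obtain ⟨h1, h2⟩ := 𝒢.mult_addMult_gate hG hp hj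
  rw [sum_addMult_mul_inverse hG hb i hj, h1, h2, 𝒢.addMult_of_mem hp.1 hj]
  linear_combination 𝒢.mult i p * (𝒢.mult p j - 1) * Ring.mul_inverse_cancel _ (ha f)

/-- The preceding identity makes the left side constant for `j` in one block; adjacent vertices
share a block, so it is constant along a walk from `j` to `i`. -/
theorem sum_addMult_mul_corr_add_mult (i j : V) :
    ∑ k, 𝒢.addMult i k * 𝒢.corr k j + 𝒢.mult i j =
      ∑ k, 𝒢.addMult i k * 𝒢.corr k i + 1 := by
  rw [← 𝒢.mult_self i]
  obtain ⟨q⟩ := hG.preconnected j i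
  induction q with
  | nil => rw [𝒢.mult_self]
  | @cons u v i h _ ih =>
    rw [← ih]
    obtain ⟨f, hu, hv⟩ := exists_block_of_adj h
    obtain ⟨p, hp⟩ := exists_isGate hG f i
    have h1 := sum_addMult_mul_inverse_gate hG hb ha hp hu
    have h2 := sum_addMult_mul_inverse_gate hG hb ha hp hv
    exact sub_left_injective (h1.symm.trans h2)

end Sums

theorem distMatrix_mul_C (hG : (undir G).Connected) (hM : IsUnit 𝒢.multMatrix)
    (hD : IsUnit 𝒢.distMatrix) (v₀ : V) (w : (f : Block G) → f.1) (i j : V) :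
    (𝒢.distMatrix * 𝒢.C v₀ w) i j =
      𝒢.mult i j - 𝒢.ratio v₀ * (𝒢.distMatrix *ᵥ 𝒢.tauOut) i := by
  have ha := 𝒢.isUnit_a hG hD
  choose p hp using fun e : Block G => exists_isGate hG e i
  choose b hb hb' using fun k => existsUnique_subset_branch (G := G) hG k
  have hb2 : ∀ k f e, k ∈ e.1 ∧ f.1 ⊆ branch G k e ↔ e = b k f := fun k f e =>
    ⟨hb' k f e, fun h => h ▸ hb k f⟩
  have h1 : (𝒢.distMatrix * 𝒢.C v₀ w) i j =
      𝒢.ratio v₀ * ∑ f, 𝒢.blockQuot f * ∑ k, 𝒢.addMult i k * Ring.inverse (𝒢.a (b k f)) -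
        ∑ k, 𝒢.addMult i k * 𝒢.corr k j := by
    rw [Matrix.mul_apply]
    simp only [C_apply hG, mul_sub, Finset.sum_sub_distrib,
      beta_eq (𝒢.isUnit_Dstar hG hM) ha v₀ w (hb2 _), Finset.mul_sum]
    rw [Finset.sum_comm]
    congr 1
    refine Finset.sum_congr rfl fun f _ => Finset.sum_congr rfl fun k _ => ?_
    rw [distMatrix, Matrix.of_apply]
    ring
  have h2 : ∀ f, ∑ k, 𝒢.addMult i k * Ring.inverse (𝒢.a (b k f)) =
      (∑ k, 𝒢.addMult i k * 𝒢.corr k j + 𝒢.mult i j) -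
        (𝒢.mult i (p f) - 𝒢.addMult i (p f) * Ring.inverse (𝒢.a f)) := by
    intro f
    -- `j` need not lie in `f`: the identity is used at the gate and carried over to `j` by
    -- constancy.
    rw [sum_addMult_mul_inverse_gate hG hb2 ha (hp f) (hp f).1,
      sum_addMult_mul_corr_add_mult hG hb2 ha i j, sum_addMult_mul_corr_add_mult hG hb2 ha i (p f)]
  rw [h1, distMatrix_mulVec_tauOut hG hM hp ha]
  simp only [h2, mul_sub (𝒢.blockQuot _) (_ + _), Finset.sum_sub_distrib, ← Finset.sum_mul]
  linear_combination (∑ k, 𝒢.addMult i k * 𝒢.corr k j + 𝒢.mult i j) *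
    sum_blockQuot_mul_ratio hG hM hD v₀

end BlockDatum

end BlockGraph

end

theorem theoremC {V : Type*} [Fintype V] [DecidableEq V] {R : Type*} [CommRing R]
    (G : Digraph V) (hsimple : ∀ v, ¬ G.Adj v v) (hconn : BlockGraph.StronglyConnected G)
    (𝒢 : BlockGraph.BlockDatum G R)
    (hD : IsUnit 𝒢.distMatrix) (hDstar : IsUnit 𝒢.multMatrix)
    (v₀ : V) (w : (f : BlockGraph.Block G) → f.1) :
    (∀ e : BlockGraph.Block G, IsUnit (𝒢.a e)) ∧
    (∀ f : BlockGraph.Block G, IsUnit (𝒢.kappaBlock f (w f))) ∧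
    (𝒢.distMatrix)⁻¹ =
      𝒢.ratio v₀ • Matrix.vecMulVec 𝒢.tauOut 𝒢.tauIn
        + 𝒢.C v₀ w * (𝒢.multMatrix)⁻¹ := by
  have : Nonempty V := ⟨v₀⟩
  have hG := hconn.connected_undir
  have ha := 𝒢.isUnit_a hG hD
  have hM := 𝒢.isUnit_Dstar hG hDstar
  refine ⟨ha, fun f => ?_, ?_⟩
  · rw [𝒢.kappaBlock_eq]
    exact ((ha f).pow _).mul ((Matrix.isUnit_iff_isUnit_det _).1 (hM f))
  · refine Matrix.inv_eq_right_inv ?_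
    have h1 : 𝒢.distMatrix * 𝒢.C v₀ w =
        𝒢.multMatrix - 𝒢.ratio v₀ • Matrix.vecMulVec (𝒢.distMatrix.mulVec 𝒢.tauOut) 1 := by
      ext i j
      rw [BlockGraph.BlockDatum.distMatrix_mul_C hG hDstar hD]
      simp [BlockGraph.BlockDatum.multMatrix]
    rw [Matrix.mul_add, ← Matrix.mul_assoc, h1, Matrix.sub_mul,
      Matrix.mul_nonsing_inv _ ((Matrix.isUnit_iff_isUnit_det _).1 hDstar), Matrix.mul_smul,
      Matrix.mul_vecMulVec, Matrix.smul_mul, Matrix.vecMulVec_mul, BlockGraph.BlockDatum.tauIn]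
    abel
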